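/- All graphs are finite and simple. For a graph $G$ and a list assignment $L$ (a map giving each vertex $v$ a finite set $L(v)$ of colors), a proper $L$-coloring of $G$ is a map $f$ on $V(G)$ with $f(v)\in L(v)$ for all $v$ and $f(u)\neq f(v)$ whenever $u,v$ are adjacent; two proper $L$-colorings $f,g$ are equivalent if $f\circ\pi=g$ for some $\pi\in\mathrm{Aut}(G)$, and $u_\ell(G,L)$ is the number of equivalence classes. $L$ is a $k$-assignment if $|L(v)|=k$ for all $v$. An unlabeled graph $\mathcal G$ of order $n$ is an isomorphism class of graphs on the vertex set $\{v_1,\dots,v_n\}$. Let $P(\mathcal G,k)$ be the number of orbits of the symmetric group on $\{v_1,\dots,v_n\}$ acting by $\pi\cdot(G,f)=(\pi G,f\circ\pi^{-1})$ on the pairs $(G,f)$ with $G\in\mathcal G$ and $f:V(G)\to\{1,\dots,k\}$ a proper coloring of $G$, where $\pi G$ has the edges $\pi(u)\pi(v)$ for $uv\in E(G)$. Let $P_\ell(\mathcal G,k)$ be the minimum of $u_\ell(G,L)$ over all $k$-assignments $L$ for $G$, where $G$ is any fixed member of $\mathcal G$ (the choice does not matter). **Theorem.** Let $G$ be a graph,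 possibly with no vertices. Suppose that $G$ is point-determining, that is, no two distinct vertices of $G$ have the same (open) neighborhood, and that every non-identity automorphism of $G$, written as a product of disjoint cycles, has a cycle containing two vertices that are adjacent in $G$. Let $G'$ be the graph obtained from $G$ by adding two new nonadjacent vertices $x$ and $y$, each adjacent to every vertex of $G$, and let $\mathcal G'$ be the unlabeled graph of $G'$ (the isomorphism class of the copies of $G'$ on $\{v_1,\dots,v_{|V(G)|+2}\}$). Then there is an $N\in\mathbb N$ such that $P_\ell(\mathcal G',k)=P(\mathcal G',k)$ for all $k\geq N$. -/

import Mathlib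

namespace UnlabeledColoring

/-! ### Labeled graphs -/

/-- `f` is a proper coloring of `G`: adjacent vertices receive different colors. -/
def IsProper {V C : Type*} (G : SimpleGraph V) (f : V → C) : Prop :=
  ∀ u v, G.Adj u v → f u ≠ f v

/-- `G` is point-determining: no two distinct vertices have the same neighborhood. -/
def PointDetermining {V : Type*} (G : SimpleGraph V) : Prop :=
  ∀ u v, u ≠ v → G.neighborSet u ≠ G.neighborSet v

/-- The cycle decomposition of `π` (with all its `1`-cycles) has a cycle that contains two vertices
which are adjacent in `G`. -/
def HasCycleWithAdjacentVertices {V : Type*} (G : SimpleGraph V) (π : Equiv.Perm V) : Prop :=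
  ∃ u v, π.SameCycle u v ∧ G.Adj u v

/-- The join of `G` and `H`: their disjoint union together with all edges between them. -/
def join {V W : Type*} (G : SimpleGraph V) (H : SimpleGraph W) : SimpleGraph (V ⊕ W) where
  Adj
    | Sum.inl u, Sum.inl v => G.Adj u v
    | Sum.inr u, Sum.inr v => H.Adj u v
    | Sum.inl _, Sum.inr _ => True
    | Sum.inr _, Sum.inl _ => True
  symm.symm
    | Sum.inl _, Sum.inl _ => fun h => G.adj_symm h
    | Sum.inr _, Sum.inr _ => fun h => H.adj_symm h
    | Sum.inl _, Sum.inr _ => id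
    | Sum.inr _, Sum.inl _ => id
  loopless.irrefl
    | Sum.inl _ => fun h => G.irrefl h
    | Sum.inr _ => fun h => H.irrefl h

/-- The graph obtained from `G` by adding two nonadjacent vertices `x = Sum.inr 0` and
`y = Sum.inr 1`, each adjacent to every vertex of `G`. -/
def addTwoVertices {V : Type*} (G : SimpleGraph V) : SimpleGraph (V ⊕ Fin 2) :=
  join G (⊥ : SimpleGraph (Fin 2))

/-! ### List colorings up to automorphism -/

/-- `L` is a `k`-assignment: it gives each vertex a list of exactly `k` colors. -/
def IsAssignment {V : Type*} (k : ℕ) (L : V → Finset ℕ) : Prop :=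
  ∀ v, (L v).card = k

/-- The proper `L`-colorings of `G`. -/
def ListColoring {V : Type*} (G : SimpleGraph V) (L : V → Finset ℕ) : Type _ :=
  {f : V → ℕ // (∀ v, f v ∈ L v) ∧ IsProper G f}

/-- Proper `L`-colorings `f` and `g` of `G` are equivalent if `f ∘ π = g` for an automorphism `π`
of `G`. -/
def listColoringSetoid {V : Type*} (G : SimpleGraph V) (L : V → Finset ℕ) :
    Setoid (ListColoring G L) where
  r f g := ∃ π : G ≃g G, f.1 ∘ π = g.1
  iseqv :=
    { refl := fun _ => ⟨RelIso.refl _, rfl⟩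
      symm := by
        rintro f g ⟨π, h⟩
        refine ⟨π.symm, ?_⟩
        rw [← h]
        funext v
        simp
      trans := by
        rintro f g l ⟨π, h⟩ ⟨σ, h'⟩
        refine ⟨σ.trans π, ?_⟩
        rw [← h', ← h]
        rfl }

/-- The number of proper `L`-colorings of `G` up to equivalence. -/
noncomputable def numListColorings {V : Type*} (G : SimpleGraph V) (L : V → Finset ℕ) : ℕ :=
  Nat.card (Quotient (listColoringSetoid G L))

/-- The minimum, over all `k`-assignments `L`, of the number of proper `L`-colorings of `G` up to
equivalence. -/
noncomputable def minNumListColorings {V : Type*} (G : SimpleGraph V) (k : ℕ) : ℕ :=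
  sInf {m | ∃ L : V → Finset ℕ, IsAssignment k L ∧ numListColorings G L = m}

/-- The infimum in the definition of `minNumListColorings` is a minimum. -/
theorem minNumListColorings_isLeast {V : Type*} (G : SimpleGraph V) (k : ℕ) :
    IsLeast {m | ∃ L : V → Finset ℕ, IsAssignment k L ∧ numListColorings G L = m}
      (minNumListColorings G k) := by
  have hne : {m | ∃ L : V → Finset ℕ, IsAssignment k L ∧ numListColorings G L = m}.Nonempty :=
    ⟨_, fun _ => Finset.range k, fun _ => Finset.card_range k, rfl⟩
  exact ⟨Nat.sInf_mem hne, fun _ h => Nat.sInf_le h⟩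

/-- Transport of list colorings along a graph isomorphism. -/
def listColoringEquiv {V W : Type*} {G : SimpleGraph V} {H : SimpleGraph W} (e : G ≃g H)
    (L : V → Finset ℕ) : ListColoring G L ≃ ListColoring H (L ∘ e.symm) where
  toFun f := ⟨f.1 ∘ e.symm, fun w => f.2.1 (e.symm w),
    fun u v h => f.2.2 _ _ (e.symm.map_adj_iff.2 h)⟩
  invFun g := ⟨g.1 ∘ e, fun v => by simpa using g.2.1 (e v),
    fun u v h => g.2.2 _ _ (e.map_adj_iff.2 h)⟩
  left_inv f := Subtype.ext (funext fun v => by simp)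
  right_inv g := Subtype.ext (funext fun w => by simp)

theorem numListColorings_iso {V W : Type*} {G : SimpleGraph V} {H : SimpleGraph W} (e : G ≃g H)
    (L : V → Finset ℕ) : numListColorings H (L ∘ e.symm) = numListColorings G L := by
  refine (Nat.card_congr (Quotient.congr (listColoringEquiv e L) ?_)).symm
  intro f g
  constructor
  · rintro ⟨π, h⟩
    refine ⟨(e.symm.trans π).trans e, ?_⟩
    funext w
    change f.1 (e.symm (e (π (e.symm w)))) = g.1 (e.symm w)
    rw [e.symm_apply_apply]
    exact congrFun h (e.symm w)
  · rintro ⟨σ, h⟩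
    refine ⟨(e.trans σ).trans e.symm, ?_⟩
    funext v
    have hv : f.1 (e.symm (σ (e v))) = g.1 (e.symm (e v)) := congrFun h (e v)
    rw [e.symm_apply_apply] at hv
    exact hv

theorem minNumListColorings_iso {V W : Type*} {G : SimpleGraph V} {H : SimpleGraph W}
    (e : G ≃g H) (k : ℕ) : minNumListColorings G k = minNumListColorings H k := by
  unfold minNumListColorings
  congr 1
  ext m
  constructor
  · rintro ⟨L, hL, rfl⟩
    exact ⟨L ∘ e.symm, fun w => hL _, numListColorings_iso e L⟩
  · rintro ⟨L, hL, rfl⟩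
    exact ⟨L ∘ e, fun v => hL _, numListColorings_iso e.symm L⟩

/-! ### Unlabeled graphs -/

/-- Isomorphism of graphs on the vertex set `Fin n`. -/
def isoSetoid (n : ℕ) : Setoid (SimpleGraph (Fin n)) where
  r G H := Nonempty (G ≃g H)
  iseqv :=
    { refl := fun _ => ⟨RelIso.refl _⟩
      symm := fun ⟨e⟩ => ⟨e.symm⟩
      trans := fun ⟨e⟩ ⟨e'⟩ => ⟨e.trans e'⟩ }

/-- An unlabeled graph of order `n`: an isomorphism class of graphs on the vertex set `Fin n`. -/
def UnlabeledGraph (n : ℕ) : Type :=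
  Quotient (isoSetoid n)

namespace UnlabeledGraph

/-- The unlabeled graph (isomorphism class) to which a graph on `Fin n` belongs. -/
def mk {n : ℕ} (G : SimpleGraph (Fin n)) : UnlabeledGraph n :=
  Quotient.mk (isoSetoid n) G

/-- The unlabeled graph of a graph on an arbitrary finite vertex set. It does not depend on the
enumeration of the vertices that is used. -/
noncomputable def of {V : Type*} [Fintype V] (G : SimpleGraph V) :
    UnlabeledGraph (Fintype.card V) :=
  mk (G.map (Fintype.equivFin V))

/-- The graph `πG`, with edges `{π u, π v}` for the edges `{u, v}` of `G`, is isomorphic to `G`. -/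
theorem mk_map {n : ℕ} (π : Equiv.Perm (Fin n)) (G : SimpleGraph (Fin n)) :
    mk (G.map π) = mk G :=
  Quotient.sound ⟨(SimpleGraph.Iso.map π G).symm⟩

/-- The pairs `(G, f)` where `G` belongs to `𝒢` and `f` is a proper `k`-coloring of `G`. -/
def LabeledColoring {n : ℕ} (𝒢 : UnlabeledGraph n) (k : ℕ) : Type :=
  {p : SimpleGraph (Fin n) × (Fin n → Fin k) // mk p.1 = 𝒢 ∧ IsProper p.1 p.2}

/-- The action `π • (G, f) = (πG, f ∘ π⁻¹)` of the symmetric group. -/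
instance labeledColoringAction {n : ℕ} (𝒢 : UnlabeledGraph n) (k : ℕ) :
    MulAction (Equiv.Perm (Fin n)) (LabeledColoring 𝒢 k) where
  smul π p := ⟨(p.1.1.map π, p.1.2 ∘ ⇑π⁻¹), (mk_map π p.1.1).trans p.2.1, by
    rintro _ _ ⟨-, u, v, h, rfl, rfl⟩
    simpa using p.2.2 u v h⟩
  one_smul p := by
    refine Subtype.ext (Prod.ext ?_ ?_)
    · exact SimpleGraph.map_id p.1.1
    · rfl
  mul_smul π σ p := by
    refine Subtype.ext (Prod.ext ?_ ?_)
    · exact (SimpleGraph.map_map p.1.1 σ π).symm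
    · change p.1.2 ∘ ⇑(π * σ)⁻¹ = (p.1.2 ∘ ⇑σ⁻¹) ∘ ⇑π⁻¹
      rw [mul_inv_rev]
      rfl

/-- The unlabeled chromatic polynomial at `k`: the number of proper `k`-colorings of the unlabeled
graph `𝒢`, which are the orbits of the symmetric group on the pairs `(G, f)`. -/
noncomputable def numColorings {n : ℕ} (𝒢 : UnlabeledGraph n) (k : ℕ) : ℕ :=
  Nat.card (MulAction.orbitRel.Quotient (Equiv.Perm (Fin n)) (LabeledColoring 𝒢 k))

/-- The unlabeled list color function: the minimum of the number of proper `L`-colorings of `G` up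
to equivalence over all `k`-assignments `L`, for an arbitrary member `G` of `𝒢`. -/
noncomputable def listColorFunction {n : ℕ} (𝒢 : UnlabeledGraph n) (k : ℕ) : ℕ :=
  Quotient.lift (s := isoSetoid n) (fun G : SimpleGraph (Fin n) => minNumListColorings G k)
    (fun _ _ h => h.elim fun e => minNumListColorings_iso e k) 𝒢

end UnlabeledGraph

end UnlabeledColoring

namespace UnlabeledColoring

open Finset

/-! The point is that constant lists minimize the count for large `k`. Colorings up to automorphism
are counted by Burnside (`numListColorings_mul_card`), applied to the closure of the `L`-colorings
under automorphisms.

Point-determination forces automorphisms of `addTwoVertices G` to preserve `G` and {x, y}. An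
automorphism fixing a proper coloring makes it constant on cycles, so it acts trivially on `G`: only
the identity and the swap of x and y remain (`eq_one_or_eq_swapNew`). With constant lists, the fixed
pairs therefore number the proper colorings of `addTwoVertices G` plus those of `cone G`, where x
and y are merged. For arbitrary lists the corresponding sum is still a lower bound:
`toFixedColoring` injects both sets of list colorings into the fixed pairs.

It remains to minimize ordinary list colorings of these two graphs
(`exists_card_listColoring_const_le`). In inclusion–exclusion over edge sets, a color missing from
an edge gains order `k ^ (n - 2)` in the single-edge terms and costs at most order `k ^ (n - 3)` in
the terms with more edges. -/

/-- If every factor lies between `k - B` and `k`, the product is close to a power of `k`. -/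
theorem pow_le_prod_add {ι : Type*} (s : Finset ι) (m : ι → ℕ) (k B : ℕ)
    (hm : ∀ i ∈ s, m i ≤ k) (hB : ∀ i ∈ s, k ≤ m i + B) :
    k ^ (#s + 1) ≤ k * ∏ i ∈ s, m i + #s * k ^ #s * B := by
  classical
  induction s using Finset.induction_on with
  | empty => simp
  | insert a s ha ih =>
    rw [card_insert_of_notMem ha, prod_insert ha]
    have h1 := ih (fun i hi => hm i (mem_insert_of_mem hi)) fun i hi => hB i (mem_insert_of_mem hi)
    have h2 := hB a (mem_insert_self a s)
    have h3 : ∏ i ∈ s, m i ≤ k ^ #s :=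
      prod_le_pow_card _ _ _ fun i hi => hm i (mem_insert_of_mem hi)
    calc k ^ (#s + 1 + 1) = k * k ^ (#s + 1) := by ring
      _ ≤ k * (k * ∏ i ∈ s, m i + #s * k ^ #s * B) := Nat.mul_le_mul_left _ h1
      _ = k * (∏ i ∈ s, m i) * k + #s * k ^ (#s + 1) * B := by ring
      _ ≤ k * (∏ i ∈ s, m i) * (m a + B) + #s * k ^ (#s + 1) * B := by gcongr
      _ = k * (m a * ∏ i ∈ s, m i) + k * B * (∏ i ∈ s, m i) + #s * k ^ (#s + 1) * B := by ring
      _ ≤ k * (m a * ∏ i ∈ s, m i) + k * B * k ^ #s + #s * k ^ (#s + 1) * B := by gcongr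
      _ = _ := by ring

/-! ### Ordinary list colorings: inclusion–exclusion over edge sets -/

open scoped Classical in
/-- The colors that the list assignment `L` makes available at every vertex of `S`. -/
noncomputable def commonColors {V : Type*} [Fintype V] (L : V → Finset ℕ) (S : Set V) :
    Finset ℕ :=
  {c ∈ univ.biUnion L | ∀ v ∈ S, c ∈ L v}

open scoped Classical in
/-- The `L`-colorings, proper or not, for which both ends of every edge in `A` get the same
color. -/
noncomputable def monochromatic {V : Type*} [Fintype V] (L : V → Finset ℕ)
    (A : Finset (Sym2 V)) : Finset (V → ℕ) :=
  {f ∈ Fintype.piFinset L | ∀ e ∈ A, (e.map f).IsDiag}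

/-- The number of connected components of the graph with edge set `A`. -/
noncomputable def numComponents {V : Type*} (A : Finset (Sym2 V)) : ℕ :=
  Nat.card (SimpleGraph.fromEdgeSet (A : Set (Sym2 V))).ConnectedComponent

section ListColorings

variable {V : Type*} [Fintype V]

theorem mem_commonColors {L : V → Finset ℕ} {S : Set V} (hS : S.Nonempty) {c : ℕ} :
    c ∈ commonColors L S ↔ ∀ v ∈ S, c ∈ L v := by
  obtain ⟨v, hv⟩ := hS
  simp only [commonColors, mem_filter, mem_biUnion, mem_univ, true_and, and_iff_right_iff_imp]
  exact fun h => ⟨v, h v hv⟩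

theorem commonColors_subset {L : V → Finset ℕ} {S : Set V} {v : V} (hv : v ∈ S) :
    commonColors L S ⊆ L v :=
  fun _ hc => (mem_commonColors ⟨v, hv⟩).1 hc v hv

/-- Inclusion–exclusion: expand, for each coloring, the product over the edges of 1 minus the
indicator that the edge is monochromatic. -/
theorem card_listColoring_eq_sum (H : SimpleGraph V) (L : V → Finset ℕ)
    [Fintype H.edgeSet] :
    (Nat.card (ListColoring H L) : ℤ) =
      ∑ A ∈ H.edgeFinset.powerset, (-1) ^ #A * (#(monochromatic L A) : ℤ) := by
  classical
  have h1 : Nat.card (ListColoring H L) =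
      #{f ∈ Fintype.piFinset L | ∀ e ∈ H.edgeFinset, ¬ (e.map f).IsDiag} := by
    refine Nat.subtype_card _ fun f => ?_
    simp only [mem_filter, Fintype.mem_piFinset, SimpleGraph.mem_edgeFinset, IsProper]
    refine and_congr_right fun _ => ⟨fun h u v huv => ?_, fun h e => ?_⟩
    · simpa using h s(u, v) huv
    · induction e with | _ u v => simpa using h u v
  have h2 (f : V → ℕ) : (if ∀ e ∈ H.edgeFinset, ¬ (e.map f).IsDiag then (1 : ℤ) else 0) =
      ∑ A ∈ H.edgeFinset.powerset, (-1) ^ #A * (if ∀ e ∈ A, (e.map f).IsDiag then 1 else 0) := by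
    have h3 : ∀ A : Finset (Sym2 V), ∏ e ∈ A, -(if (e.map f).IsDiag then (1 : ℤ) else 0) =
        (-1) ^ #A * (if ∀ e ∈ A, (e.map f).IsDiag then 1 else 0) := fun A => by
      rw [prod_neg, prod_boole]
      congr
    simp_rw [← h3]
    rw [← prod_one_add]
    split_ifs with h
    · exact (prod_eq_one fun e he => by simp [h e he]).symm
    · push Not at h
      obtain ⟨e, he, h⟩ := h
      exact (prod_eq_zero he (by simp [h])).symm
  rw [h1, card_filter, Nat.cast_sum]
  simp only [Nat.cast_ite, Nat.cast_one, Nat.cast_zero, h2]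
  rw [sum_comm]
  refine sum_congr rfl fun A _ => ?_
  rw [monochromatic, card_filter, Nat.cast_sum, mul_sum]
  simp

/-- Such a coloring is constant on each component, and the components choose their common colors
independently. -/
theorem card_monochromatic (L : V → Finset ℕ) (A : Finset (Sym2 V))
    [Fintype (SimpleGraph.fromEdgeSet (A : Set (Sym2 V))).ConnectedComponent] :
    #(monochromatic L A) =
      ∏ C : (SimpleGraph.fromEdgeSet (A : Set (Sym2 V))).ConnectedComponent,
        #(commonColors L C.supp) := by
  classical
  rw [← Fintype.card_piFinset]
  symm
  refine card_bij
    (fun g _ v => g ((SimpleGraph.fromEdgeSet (A : Set (Sym2 V))).connectedComponentMk v))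
    ?_ ?_ ?_
  · intro g hg
    rw [Fintype.mem_piFinset] at hg
    simp only [monochromatic, mem_filter, Fintype.mem_piFinset]
    refine ⟨fun v => commonColors_subset (by simp) (hg _), fun e he => ?_⟩
    induction e with | _ u v =>
    by_cases huv : u = v
    · simp [huv]
    · simp only [Sym2.map_mk, Sym2.mk_isDiag_iff]
      congr 1
      exact SimpleGraph.ConnectedComponent.sound
        (SimpleGraph.Adj.reachable (by simpa [huv] using he))
  · intro g _ g' _ h
    funext C
    obtain ⟨v, rfl⟩ := C.exists_rep
    exact congrFun h v
  · intro f hf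
    simp only [monochromatic, mem_filter, Fintype.mem_piFinset] at hf
    have hadj : ∀ u v, (SimpleGraph.fromEdgeSet (A : Set (Sym2 V))).Reachable u v → f u = f v := by
      rintro u v ⟨p⟩
      induction p with
      | nil => rfl
      | cons h _ ih =>
        refine Eq.trans ?_ ih
        exact Sym2.mk_isDiag_iff.1 (hf.2 s(_, _) (by simpa using h.1))
    refine ⟨fun C => f C.out, ?_, funext fun v => hadj _ _ ?_⟩
    · rw [Fintype.mem_piFinset]
      intro C
      refine (mem_commonColors C.nonempty_supp).2 fun v hv => ?_
      rw [hadj _ v]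
      · exact hf.1 v
      · refine SimpleGraph.ConnectedComponent.exact ?_
        rw [SimpleGraph.ConnectedComponent.mem_supp_iff] at hv
        rw [hv]
        exact Quot.out_eq C
    · refine SimpleGraph.ConnectedComponent.exact ?_
      exact Quot.out_eq _

theorem card_monochromatic_const (k : ℕ) (A : Finset (Sym2 V)) :
    #(monochromatic (fun _ : V => range k) A) = k ^ numComponents A := by
  classical
  rw [card_monochromatic, numComponents, Nat.card_eq_fintype_card, ← card_univ]
  refine (prod_congr rfl fun C _ => ?_).trans (prod_const k)
  suffices commonColors (fun _ : V => range k) C.supp = range k by rw [this, card_range]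
  ext c
  rw [mem_commonColors C.nonempty_supp]
  obtain ⟨v, hv⟩ := C.nonempty_supp
  exact ⟨fun h => h v hv, fun h _ _ => h⟩

theorem card_commonColors_le {k : ℕ} {L : V → Finset ℕ} (hL : IsAssignment k L) {S : Set V}
    (hS : S.Nonempty) : #(commonColors L S) ≤ k := by
  obtain ⟨v, hv⟩ := hS
  exact (card_le_card (commonColors_subset hv)).trans (hL v).le

theorem card_monochromatic_le {k : ℕ} {L : V → Finset ℕ} (hL : IsAssignment k L)
    (A : Finset (Sym2 V)) : #(monochromatic L A) ≤ k ^ numComponents A := by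
  classical
  rw [card_monochromatic, numComponents, Nat.card_eq_fintype_card, ← card_univ]
  exact prod_le_pow_card _ _ _ fun C _ => card_commonColors_le hL C.nonempty_supp

/-- A color of a vertex that is not common to its whole component is lost along some edge, so the
edges of `A` bound the number of such colors. -/
theorem le_card_commonColors_add {k : ℕ} {L : V → Finset ℕ} (hL : IsAssignment k L)
    (A : Finset (Sym2 V)) (C : (SimpleGraph.fromEdgeSet (A : Set (Sym2 V))).ConnectedComponent) :
    k ≤ #(commonColors L C.supp) + 2 * ∑ e ∈ A, (k - #(commonColors L (e : Set V))) := by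
  classical
  obtain ⟨r, hr⟩ := C.nonempty_supp
  -- These are the colors lost along `e`. Each end has `k - #(commonColors L e)` of them, hence the
  -- factor 2.
  let D : Sym2 V → Finset ℕ := fun e =>
    {c ∈ univ.biUnion L | (∃ v ∈ e, c ∈ L v) ∧ c ∉ commonColors L (e : Set V)}
  have hD : ∀ e, #(D e) ≤ 2 * (k - #(commonColors L (e : Set V))) := by
    intro e
    induction e with | _ u v =>
    have hsub : D s(u, v) ⊆ (L u \ commonColors L (s(u, v) : Set V)) ∪
        (L v \ commonColors L (s(u, v) : Set V)) := by
      intro c hc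
      simp only [D, mem_filter] at hc
      obtain ⟨-, ⟨w, hw, hcw⟩, hc⟩ := hc
      rcases Sym2.mem_iff.1 hw with rfl | rfl
      · exact mem_union_left _ (mem_sdiff.2 ⟨hcw, hc⟩)
      · exact mem_union_right _ (mem_sdiff.2 ⟨hcw, hc⟩)
    refine (card_le_card hsub).trans ((card_union_le _ _).trans ?_)
    rw [card_sdiff_of_subset (commonColors_subset (by simp)),
      card_sdiff_of_subset (commonColors_subset (by simp)), hL u, hL v, two_mul]
  have hsub : L r ⊆ commonColors L C.supp ∪ A.biUnion D := by
    intro c hc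
    by_contra hcon
    simp only [mem_union, mem_biUnion, not_or, not_exists, not_and] at hcon
    refine hcon.1 ((mem_commonColors C.nonempty_supp).2 fun v hv => ?_)
    have hreach : (SimpleGraph.fromEdgeSet (A : Set (Sym2 V))).Reachable r v :=
      SimpleGraph.ConnectedComponent.exact (hr.trans hv.symm)
    obtain ⟨p⟩ := hreach
    clear hr hv
    induction p with
    | nil => exact hc
    | @cons a b _ h _ ih =>
      refine ih ?_
      by_contra hb
      refine hcon.2 s(a, b) (by simpa using h.1) ?_
      simp only [D, mem_filter, mem_biUnion, mem_univ, true_and]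
      exact ⟨⟨a, hc⟩, ⟨a, by simp, hc⟩, fun h' => hb (commonColors_subset (by simp) h')⟩
  calc k = #(L r) := (hL r).symm
    _ ≤ #(commonColors L C.supp) + #(A.biUnion D) :=
      (card_le_card hsub).trans (card_union_le _ _)
    _ ≤ #(commonColors L C.supp) + ∑ e ∈ A, #(D e) := by gcongr; exact card_biUnion_le
    _ ≤ _ := by rw [mul_sum]; gcongr with e _; exact hD e

theorem numComponents_le (A : Finset (Sym2 V)) : numComponents A ≤ Fintype.card V := by
  rw [← Nat.card_eq_fintype_card]
  exact Nat.card_le_card_of_surjective _ Quot.mk_surjective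

theorem numComponents_add_two_le {A : Finset (Sym2 V)} (hA : ∀ e ∈ A, ¬ e.IsDiag)
    (h2 : 1 < #A) : numComponents A + 2 ≤ Fintype.card V := by
  classical
  obtain ⟨e₁, h₁, e₂, h₂, hne⟩ := one_lt_card.1 h2
  -- Here `v` and `z` are to be discarded while every component keeps a vertex. The case `w = v` is
  -- allowed: then `u` represents `z` as well.
  have key : ∃ u v w z : V, v ≠ z ∧ u ≠ v ∧ w ≠ z ∧ u ≠ z ∧ s(u, v) ∈ A ∧ s(w, z) ∈ A := by
    induction e₁ with | _ a b =>
    induction e₂ with | _ c d =>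
    have hab : a ≠ b := by simpa using hA _ h₁
    have hcd : c ≠ d := by simpa using hA _ h₂
    by_cases hd : d = a ∨ d = b
    · refine ⟨a, b, d, c, ?_, hab, hcd.symm, ?_, h₁, by rwa [Sym2.eq_swap]⟩
      · rintro rfl
        rcases hd with rfl | rfl
        · exact hne Sym2.eq_swap
        · exact hcd rfl
      · rintro rfl
        rcases hd with rfl | rfl
        · exact hcd rfl
        · exact hne rfl
    · push Not at hd
      exact ⟨a, b, c, d, hd.2.symm, hab, hcd, hd.1.symm, h₁, h₂⟩
  obtain ⟨u, v, w, z, hvz, huv, hwz, huz, h₁, h₂⟩ := key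
  let comp := (SimpleGraph.fromEdgeSet (A : Set (Sym2 V))).connectedComponentMk
  have e1 : comp u = comp v := SimpleGraph.ConnectedComponent.sound
    (SimpleGraph.Adj.reachable (by simpa [huv] using h₁))
  have e2 : comp w = comp z := SimpleGraph.ConnectedComponent.sound
    (SimpleGraph.Adj.reachable (by simpa [hwz] using h₂))
  have hsurj : Function.Surjective fun t : {t : V // t ∉ ({v, z} : Finset V)} => comp t.1 := by
    intro C
    obtain ⟨t, rfl⟩ := C.exists_rep
    have hu : u ∉ ({v, z} : Finset V) := by simp [huv, huz]
    by_cases ht : t = v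
    · exact ⟨⟨u, hu⟩, by rw [ht]; exact e1⟩
    by_cases ht' : t = z
    · by_cases hwv : w = v
      · exact ⟨⟨u, hu⟩, by rw [ht']; exact e1.trans (hwv ▸ e2)⟩
      · exact ⟨⟨w, by simp [hwv, hwz]⟩, by rw [ht']; exact e2⟩
    · exact ⟨⟨t, by simp [ht, ht']⟩, rfl⟩
  have := Nat.card_le_card_of_surjective _ hsurj
  rw [Nat.subtype_card ({v, z}ᶜ : Finset V) (by simp), card_compl, card_pair hvz] at this
  have h3 := card_le_univ ({u, v, z} : Finset V)
  rw [card_eq_three.2 ⟨u, v, z, huv, huz, hvz, rfl⟩] at h3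
  unfold numComponents
  omega

theorem card_le_numComponents_singleton_add_one (e : Sym2 V) :
    Fintype.card V ≤ numComponents {e} + 1 := by
  classical
  induction e with | _ u v =>
  let comp :=
    (SimpleGraph.fromEdgeSet (({s(u, v)} : Finset (Sym2 V)) : Set (Sym2 V))).connectedComponentMk
  have hreach : ∀ a b,
      (SimpleGraph.fromEdgeSet (({s(u, v)} : Finset (Sym2 V)) : Set (Sym2 V))).Reachable a b →
      a = b ∨ (a = u ∨ a = v) ∧ (b = u ∨ b = v) := by
    rintro a b ⟨p⟩
    induction p with
    | nil => exact Or.inl rfl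
    | cons h _ ih =>
      have := h.1
      simp at this
      grind
  have hinj : Function.Injective fun t : {t : V // t ≠ v} => comp t.1 := by
    intro a b hab
    have := hreach _ _ (SimpleGraph.ConnectedComponent.exact hab)
    have ha := a.2
    have hb := b.2
    refine Subtype.ext ?_
    grind
  have := Nat.card_le_card_of_injective _ hinj
  rw [Nat.card_eq_fintype_card (α := {t : V // t ≠ v})] at this
  simp only [ne_eq, Fintype.card_subtype_compl, Fintype.card_unique] at this
  unfold numComponents
  omega

/-- The component of `e` can only use colors common to both ends; every other component has at most
`k` choices. The extra factor `k` avoids subtracting 1 in the exponent. -/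
theorem mul_card_monochromatic_singleton_le {k : ℕ} {L : V → Finset ℕ} (hL : IsAssignment k L)
    (e : Sym2 V) (he : ¬ e.IsDiag) :
    k * #(monochromatic L {e}) ≤ #(commonColors L (e : Set V)) * k ^ numComponents {e} := by
  classical
  induction e with | _ u v =>
  let C₀ :=
    (SimpleGraph.fromEdgeSet (({s(u, v)} : Finset (Sym2 V)) : Set (Sym2 V))).connectedComponentMk u
  have hC₀ : commonColors L C₀.supp ⊆ commonColors L (s(u, v) : Set V) := by
    intro c hc
    refine (mem_commonColors ⟨u, by simp⟩).2 fun w hw => commonColors_subset ?_ hc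
    rcases Sym2.mem_iff.1 hw with rfl | rfl
    · rfl
    · refine SimpleGraph.ConnectedComponent.sound (SimpleGraph.Adj.reachable ?_)
      have : w ≠ u := by rintro rfl; simp at he
      simp [this]
  rw [card_monochromatic, numComponents, Nat.card_eq_fintype_card, ← card_univ,
    ← mul_prod_erase _ _ (mem_univ C₀), ← card_erase_add_one (mem_univ C₀), pow_succ]
  calc _ ≤ k * (#(commonColors L (s(u, v) : Set V)) * k ^ #(univ.erase C₀)) := by
        gcongr
        exact prod_le_pow_card _ _ _ fun C _ => card_commonColors_le hL C.nonempty_supp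
    _ = _ := by ring

/-- For large `k`, no `k`-assignment admits fewer proper list colorings than the constant one. -/
theorem exists_card_listColoring_const_le (H : SimpleGraph V) :
    ∃ N : ℕ, ∀ k, N ≤ k → ∀ L : V → Finset ℕ, IsAssignment k L →
      Nat.card (ListColoring H fun _ => range k) ≤ Nat.card (ListColoring H L) := by
  classical
  set n := Fintype.card V with hn
  set P := H.edgeFinset.powerset with hP
  -- Each of the `#P` terms costs at most `2 * n * S * k ^ n` after scaling, against a total gain of
  -- `S * k ^ (n + 1)`; the final 1 makes `k` positive.
  refine ⟨#P * (2 * n) + 1, fun k hk L hL => ?_⟩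
  let α : Sym2 V → ℕ := fun e => k - #(commonColors L (e : Set V))
  let S : ℕ := ∑ e ∈ H.edgeFinset, α e
  have hdiag : ∀ e ∈ H.edgeFinset, ¬ e.IsDiag := fun e he =>
    H.not_isDiag_of_mem_edgeSet (SimpleGraph.mem_edgeFinset.1 he)
  let d : Finset (Sym2 V) → ℤ := fun A => (k : ℤ) ^ numComponents A - #(monochromatic L A)
  have hd0 : ∀ A, 0 ≤ d A := fun A => by
    have := card_monochromatic_le hL A
    have : (#(monochromatic L A) : ℤ) ≤ (k : ℤ) ^ numComponents A := by exact_mod_cast this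
    simp only [d]; linarith
  -- Scaling by `k ^ 3` turns the orders `n - 2` and `n - 3` into `n + 1` and `n`, so that small `n`
  -- needs no separate treatment.
  have hd : ∀ A ∈ P, (if #A = 1 then ((∑ e ∈ A, α e : ℕ) : ℤ) * k ^ (n + 1) else 0) -
      2 * n * S * k ^ n ≤ (k : ℤ) ^ 3 * ((-1) ^ #A * #(monochromatic L A) -
        (-1) ^ #A * #(monochromatic (fun _ : V => range k) A)) := by
    intro A hA
    rw [hP, mem_powerset] at hA
    have hrw : ((-1) ^ #A * #(monochromatic L A) -
        (-1) ^ #A * #(monochromatic (fun _ : V => range k) A) : ℤ) = - ((-1) ^ #A * d A) := by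
      rw [card_monochromatic_const]; simp only [d]; push_cast; ring
    rw [hrw]
    have herr : (0 : ℤ) ≤ 2 * n * S * k ^ n := by positivity
    rcases lt_trichotomy #A 1 with h | h | h
    · have hA0 : A = ∅ := card_eq_zero.1 (by omega)
      subst hA0
      have h0 : d ∅ ≤ 0 := by
        have hcard : #(monochromatic L ∅) = k ^ n := by
          simp [monochromatic, Fintype.card_piFinset, hL _, hn]
        simp only [d, hcard, Nat.cast_pow, sub_nonpos]
        exact pow_le_pow_right₀ (by omega) (numComponents_le ∅)
      have := hd0 ∅
      have h0 : d ∅ = 0 := by linarith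
      rw [h0]
      simpa using herr
    · obtain ⟨e, rfl⟩ := card_eq_one.1 h
      have he := hdiag e (hA (mem_singleton_self e))
      have h1 := mul_card_monochromatic_singleton_le hL e he
      have h2 := card_le_numComponents_singleton_add_one e
      have hle : #(commonColors L (e : Set V)) ≤ k := card_commonColors_le hL (by
        induction e with | _ u v => exact ⟨u, by simp⟩)
      have h1' : (k : ℤ) * #(monochromatic L {e}) ≤
          #(commonColors L (e : Set V)) * (k : ℤ) ^ numComponents {e} := by exact_mod_cast h1
      have hα : (α e : ℤ) = k - #(commonColors L (e : Set V)) := by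
        simp only [α]; push_cast [hle]; ring
      have hkd : (α e : ℤ) * k ^ numComponents {e} ≤ k * d {e} := by
        rw [hα]; simp only [d]; linarith
      have hpow : (k : ℤ) ^ n ≤ k ^ (numComponents {e} + 1) :=
        pow_le_pow_right₀ (by omega) h2
      have hk0 : (0 : ℤ) ≤ k := by positivity
      have hα0 : (0 : ℤ) ≤ α e := by positivity
      have : (α e : ℤ) * k ^ (n + 1) ≤ k ^ 3 * d {e} := by
        calc (α e : ℤ) * k ^ (n + 1) = α e * k ^ n * k := by ring
          _ ≤ α e * k ^ (numComponents {e} + 1) * k := by gcongr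
          _ = k ^ 2 * (α e * k ^ numComponents {e}) := by ring
          _ ≤ k ^ 2 * (k * d {e}) := by gcongr
          _ = _ := by ring
      simp only [h, if_true, sum_singleton]
      linarith
    -- With at least two edges there are at most `n - 2` components, and the deficit `d A` is one
    -- order below `k ^ numComponents A`; the sign of the term is then irrelevant.
    · rw [if_neg (by omega)]
      have hc := numComponents_add_two_le (fun e he => hdiag e (hA he)) h
      have hcn := numComponents_le A
      have hSA : ∑ e ∈ A, α e ≤ S := sum_le_sum_of_subset hA
      have h1 : k * k ^ numComponents A ≤ k * #(monochromatic L A) +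
          n * k ^ numComponents A * (2 * S) := by
        have := pow_le_prod_add univ
          (fun C : (SimpleGraph.fromEdgeSet (A : Set (Sym2 V))).ConnectedComponent =>
            #(commonColors L C.supp)) k (2 * S)
          (fun C _ => card_commonColors_le hL C.nonempty_supp)
          (fun C _ => (le_card_commonColors_add hL A C).trans (by gcongr))
        rw [← card_monochromatic, card_univ, ← Nat.card_eq_fintype_card] at this
        change k ^ (numComponents A + 1) ≤ _ + numComponents A * k ^ numComponents A * _ at this
        rw [← pow_succ']
        exact this.trans (by gcongr)
      have h1' : (k : ℤ) * d A ≤ n * k ^ numComponents A * (2 * S) := by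
        have : (k : ℤ) * k ^ numComponents A ≤ k * #(monochromatic L A) +
          n * k ^ numComponents A * (2 * S) := by exact_mod_cast h1
        simp only [d]; linarith
      have hpow : (k : ℤ) ^ (numComponents A + 2) ≤ k ^ n := pow_le_pow_right₀ (by omega) hc
      have h3 : (k : ℤ) ^ 3 * d A ≤ 2 * n * S * k ^ n := by
        calc (k : ℤ) ^ 3 * d A = k ^ 2 * (k * d A) := by ring
          _ ≤ (k : ℤ) ^ 2 * (n * k ^ numComponents A * (2 * S)) := by gcongr
          _ = (2 * n * S : ℤ) * k ^ (numComponents A + 2) := by ring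
          _ ≤ _ := by gcongr
      have h4 : (0 : ℤ) ≤ k ^ 3 * d A := mul_nonneg (by positivity) (hd0 A)
      rcases neg_one_pow_eq_or ℤ #A with h | h <;> rw [h] <;> linarith
  have hsum := sum_le_sum hd
  rw [← mul_sum, sum_sub_distrib, sum_sub_distrib, ← card_listColoring_eq_sum,
    ← card_listColoring_eq_sum, sum_const, nsmul_eq_mul] at hsum
  have hmain : ∑ A ∈ P, (if #A = 1 then ((∑ e ∈ A, α e : ℕ) : ℤ) * k ^ (n + 1) else 0) =
      S * k ^ (n + 1) := by
    rw [← sum_filter, hP, ← powersetCard_eq_filter, powersetCard_one, sum_map]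
    simp [S, sum_mul]
  rw [hmain] at hsum
  have hk' : (#P * (2 * n) : ℤ) ≤ k := by exact_mod_cast (Nat.le_succ _).trans hk
  have hpos : (0 : ℤ) ≤ S * k ^ (n + 1) - #P * (2 * n * S * k ^ n) := by
    have : (S * k ^ (n + 1) - #P * (2 * n * S * k ^ n) : ℤ) =
        S * k ^ n * (k - #P * (2 * n)) := by ring
    rw [this]
    exact mul_nonneg (by positivity) (by linarith)
  have hk3 : (0 : ℤ) < k ^ 3 := by
    have : 0 < k := by omega
    positivity
  have := nonneg_of_mul_nonneg_right (hpos.trans hsum) hk3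
  have : (Nat.card (ListColoring H fun _ => range k) : ℤ) ≤ Nat.card (ListColoring H L) := by
    linarith
  exact_mod_cast this

end ListColorings

/-! ### Burnside counting for list colorings -/

section Burnside

variable {V : Type*}

/-- The proper colorings that some automorphism of `H` turns into an `L`-coloring. -/
def OrbitColoring (H : SimpleGraph V) (L : V → Finset ℕ) : Type _ :=
  {f : V → ℕ // IsProper H f ∧ ∃ φ : H ≃g H, ∀ v, f (φ v) ∈ L v}

instance orbitColoringAction (H : SimpleGraph V) (L : V → Finset ℕ) :
    MulAction (H ≃g H) (OrbitColoring H L) where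
  smul φ f := ⟨f.1 ∘ φ.symm, fun u v h => f.2.1 _ _ (φ.symm.map_adj_iff.2 h), by
    obtain ⟨ψ, hψ⟩ := f.2.2
    exact ⟨ψ.trans φ, fun v => by simpa using hψ v⟩⟩
  one_smul _ := rfl
  mul_smul _ _ _ := rfl

theorem smul_orbitColoring_eq_iff {H : SimpleGraph V} {L : V → Finset ℕ} (φ : H ≃g H)
    (f g : OrbitColoring H L) : φ • f = g ↔ f.1 = g.1 ∘ φ := by
  refine Subtype.ext_iff.trans ⟨fun h => ?_, fun h => ?_⟩
  · rw [← h]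
    funext v
    exact congrArg f.1 (φ.symm_apply_apply v).symm
  · change f.1 ∘ φ.symm = g.1
    rw [h]
    funext v
    exact congrArg g.1 (φ.apply_symm_apply v)

/-- A proper `L`-coloring as a member of its orbit. -/
def ListColoring.toOrbit {H : SimpleGraph V} {L : V → Finset ℕ} (f : ListColoring H L) :
    OrbitColoring H L :=
  ⟨f.1, f.2.2, RelIso.refl _, f.2.1⟩

instance finite_orbitColoring [Finite V] (H : SimpleGraph V) (L : V → Finset ℕ) :
    Finite (OrbitColoring H L) := by
  have hfin : {f : V → ℕ | ∀ v, f v ∈ ⋃ w, (L w : Set ℕ)}.Finite :=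
    Set.Finite.pi' fun _ => Set.finite_iUnion fun w => (L w).finite_toSet
  refine (hfin.subset ?_ : {f : V → ℕ | IsProper H f ∧ ∃ φ : H ≃g H, ∀ v, f (φ v) ∈ L v}.Finite)
  rintro f ⟨-, φ, h⟩ v
  exact Set.mem_iUnion.2 ⟨φ.symm v, by simpa using h (φ.symm v)⟩

/-- The `L`-colorings need not be closed under automorphisms, so Burnside is applied to
`OrbitColoring`. Each of its orbits meets the `L`-colorings in exactly one equivalence class. -/
theorem numListColorings_mul_card (H : SimpleGraph V) (L : V → Finset ℕ) :
    numListColorings H L * Nat.card (H ≃g H) =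
      Nat.card (Σ φ : H ≃g H, MulAction.fixedBy (OrbitColoring H L) φ) := by
  rw [Nat.card_congr (MulAction.sigmaFixedByEquivOrbitsProdGroup _ _), Nat.card_prod,
    numListColorings]
  congr 1
  refine Nat.card_congr (Equiv.ofBijective (Quotient.map' ListColoring.toOrbit ?_) ⟨?_, ?_⟩)
  · rintro f g ⟨φ, h⟩
    exact ⟨φ, (smul_orbitColoring_eq_iff _ _ _).2 h.symm⟩
  · rintro ⟨f⟩ ⟨g⟩ h
    obtain ⟨φ, h⟩ := Quotient.exact h
    exact Quotient.sound ⟨φ, ((smul_orbitColoring_eq_iff _ _ _).1 h).symm⟩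
  · rintro ⟨f⟩
    obtain ⟨φ, h⟩ := f.2.2
    refine ⟨Quotient.mk _ ⟨f.1 ∘ φ, h, fun u v h => f.2.1 _ _ (φ.map_adj_iff.2 h)⟩,
      Quotient.sound ⟨φ⁻¹, ?_⟩⟩
    exact inv_smul_eq_iff.2 ((smul_orbitColoring_eq_iff _ _ _).2 rfl).symm

end Burnside

/-! ### Automorphisms of the join and the colorings they fix -/

section Join

variable {V : Type*} (G : SimpleGraph V)

/-- The automorphism that exchanges the two new vertices. -/
def swapNew : addTwoVertices G ≃g addTwoVertices G where
  toEquiv := Equiv.sumCongr (Equiv.refl V) (Equiv.swap 0 1)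
  map_rel_iff' {a b} := by
    rcases a with a | a <;> rcases b with b | b <;> exact Iff.rfl

@[simp] theorem swapNew_inl (v : V) : swapNew G (Sum.inl v) = Sum.inl v := rfl

@[simp] theorem swapNew_inr (i : Fin 2) : swapNew G (Sum.inr i) = Sum.inr (Equiv.swap 0 1 i) := rfl

theorem swapNew_ne_one : swapNew G ≠ 1 := fun h => by
  have := congrArg (fun φ : addTwoVertices G ≃g addTwoVertices G => φ (Sum.inr 0)) h
  simp at this

/-- The graph obtained from `G` by adding one vertex adjacent to every vertex of `G`. -/
abbrev cone : SimpleGraph (V ⊕ Unit) :=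
  join G (⊥ : SimpleGraph Unit)

variable {G}

theorem isProper_addTwoVertices_iff {f : V ⊕ Fin 2 → ℕ} :
    IsProper (addTwoVertices G) f ↔
      IsProper G (f ∘ Sum.inl) ∧ ∀ v i, f (Sum.inl v) ≠ f (Sum.inr i) := by
  refine ⟨fun h => ⟨fun u v huv => h (Sum.inl u) (Sum.inl v) huv,
    fun v i => h (Sum.inl v) (Sum.inr i) trivial⟩, ?_⟩
  rintro ⟨h1, h2⟩ (u | i) (v | j) h
  · exact h1 u v h
  · exact h2 u j
  · exact (h2 v i).symm
  · exact h.elim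

theorem isProper_cone_iff {f : V ⊕ Unit → ℕ} :
    IsProper (cone G) f ↔
      IsProper G (f ∘ Sum.inl) ∧ ∀ v, f (Sum.inl v) ≠ f (Sum.inr ()) := by
  refine ⟨fun h => ⟨fun u v huv => h (Sum.inl u) (Sum.inl v) huv,
    fun v => h (Sum.inl v) (Sum.inr ()) trivial⟩, ?_⟩
  rintro ⟨h1, h2⟩ (u | i) (v | j) h
  · exact h1 u v h
  · exact h2 u
  · exact (h2 v).symm
  · exact h.elim

/-- The new vertices are the only twins: vertices of `G` are told apart inside `G`, and a vertex of
`G` is adjacent to the new vertices while a new vertex is not. -/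
theorem PointDetermining.exists_eq_inr (hpd : PointDetermining G) {a b : V ⊕ Fin 2} (hab : a ≠ b)
    (h : ∀ c, (addTwoVertices G).Adj a c ↔ (addTwoVertices G).Adj b c) : ∃ i, a = Sum.inr i := by
  rcases a with u | i
  · rcases b with v | j
    · refine (hpd u v (fun huv => hab (congrArg _ huv)) ?_).elim
      ext w
      exact h (Sum.inl w)
    · exact ((h (Sum.inr j)).1 trivial).elim
  · exact ⟨i, rfl⟩

theorem PointDetermining.exists_apply_inr (hpd : PointDetermining G)
    (φ : addTwoVertices G ≃g addTwoVertices G) (i : Fin 2) : ∃ j, φ (Sum.inr i) = Sum.inr j := by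
  -- In `Fin 2`, `i + 1` is the other new vertex; automorphisms send twins to twins.
  refine hpd.exists_eq_inr (b := φ (Sum.inr (i + 1))) ?_ fun c => ?_
  · simp
  · rw [← φ.apply_symm_apply c, φ.map_adj_iff, φ.map_adj_iff]
    rcases φ.symm c with v | j <;> exact Iff.rfl

theorem PointDetermining.exists_apply_inl (hpd : PointDetermining G)
    (φ : addTwoVertices G ≃g addTwoVertices G) (v : V) : ∃ w, φ (Sum.inl v) = Sum.inl w := by
  rcases h : φ (Sum.inl v) with w | i
  · exact ⟨w, rfl⟩
  · obtain ⟨j, hj⟩ := hpd.exists_apply_inr φ.symm i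
    rw [← h, φ.symm_apply_apply] at hj
    cases hj

/-- Every automorphism of `addTwoVertices G` restricts to `G` if `G` is point-determining. -/
theorem PointDetermining.exists_restrict (hpd : PointDetermining G)
    (φ : addTwoVertices G ≃g addTwoVertices G) :
    ∃ σ : G ≃g G, ∀ v, φ (Sum.inl v) = Sum.inl (σ v) := by
  choose s hs using hpd.exists_apply_inl φ
  choose t ht using hpd.exists_apply_inl φ.symm
  refine ⟨⟨⟨s, t, fun v => ?_, fun v => ?_⟩, fun {u v} => ?_⟩, hs⟩
  · apply Sum.inl_injective (β := Fin 2)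
    rw [← ht, ← hs, φ.symm_apply_apply]
  · apply Sum.inl_injective (β := Fin 2)
    rw [← hs, ← ht, φ.apply_symm_apply]
  · change (addTwoVertices G).Adj (Sum.inl (s u)) (Sum.inl (s v)) ↔ _
    rw [← hs, ← hs, φ.map_adj_iff]
    rfl

/-- An automorphism that fixes a proper coloring of `addTwoVertices G` is trivial or exchanges the
two new vertices. -/
theorem eq_one_or_eq_swapNew (hpd : PointDetermining G)
    (haut : ∀ π : G ≃g G, π ≠ RelIso.refl G.Adj → HasCycleWithAdjacentVertices G π.toEquiv)
    (φ : addTwoVertices G ≃g addTwoVertices G) {f : V ⊕ Fin 2 → ℕ}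
    (hf : IsProper (addTwoVertices G) f) (hφ : f = f ∘ φ) : φ = 1 ∨ φ = swapNew G := by
  obtain ⟨σ, hσ⟩ := hpd.exists_restrict φ
  have hσ1 : σ = RelIso.refl G.Adj := by
    by_contra hne
    obtain ⟨u, v, ⟨i, rfl⟩, hadj⟩ := haut σ hne
    -- Invariance makes `f` constant on the cycles of `σ`, contradicting properness on a cycle with
    -- two adjacent vertices.
    have hstep : ∀ w, f (Sum.inl (σ w)) = f (Sum.inl w) := fun w => by
      rw [← hσ]
      exact (congrFun hφ (Sum.inl w)).symm
    have hpow : ∀ (i : ℤ) w, f (Sum.inl ((σ.toEquiv ^ i : Equiv.Perm V) w)) = f (Sum.inl w) := by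
      intro i
      induction i with
      | zero => exact fun w => rfl
      | succ i ih =>
        intro w
        rw [zpow_add_one, Equiv.Perm.mul_apply, ih]
        exact hstep w
      | pred i ih =>
        intro w
        rw [zpow_sub_one, Equiv.Perm.mul_apply, ih, ← hstep]
        exact congrArg (fun w => f (Sum.inl w)) (σ.toEquiv.apply_symm_apply w)
    exact hf (Sum.inl u) (Sum.inl _) hadj (hpow i u).symm
  have hinl : ∀ v, φ (Sum.inl v) = Sum.inl v := fun v => by rw [hσ, hσ1]; rfl
  obtain ⟨a, ha⟩ := hpd.exists_apply_inr φ 0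
  obtain ⟨b, hb⟩ := hpd.exists_apply_inr φ 1
  have hab : a ≠ b := fun hab => by
    have : (Sum.inr 0 : V ⊕ Fin 2) = Sum.inr 1 := φ.injective (by rw [ha, hb, hab])
    simp at this
  have hcases : (a = 0 ∧ b = 1) ∨ (a = 1 ∧ b = 0) := by omega
  rcases hcases with ⟨rfl, rfl⟩ | ⟨rfl, rfl⟩
  · left
    ext (v | i)
    · exact hinl v
    · fin_cases i
      · exact ha
      · exact hb
  · right
    ext (v | i)
    · exact hinl v
    · fin_cases i
      · exact ha
      · exact hb

/-! ### Comparing fixed pairs with list colorings of the join and of the cone -/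

/-- The coloring with the colors of `g` on `V` and the colors `a` and `b` on the new vertices. -/
def extendColoring (g : V → ℕ) (a b : ℕ) : V ⊕ Fin 2 → ℕ :=
  Sum.elim g ![a, b]

/-- The lists of `cone G` induced by lists of `addTwoVertices G`: the vertex of the cone gets the
list of the first new vertex. -/
def coneLists (L : V ⊕ Fin 2 → Finset ℕ) : V ⊕ Unit → Finset ℕ :=
  Sum.elim (L ∘ Sum.inl) fun _ => L (Sum.inr 0)

theorem isProper_extendColoring {g : V → ℕ} {a b : ℕ} (hg : IsProper G g) (ha : ∀ v, g v ≠ a)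
    (hb : ∀ v, g v ≠ b) : IsProper (addTwoVertices G) (extendColoring g a b) := by
  refine isProper_addTwoVertices_iff.2 ⟨hg, fun v i => ?_⟩
  fin_cases i
  · exact ha v
  · exact hb v

/-- Proper list colorings of `addTwoVertices G` and of `cone G` give distinct colorings together
with automorphisms that fix them. -/
noncomputable def toFixedColoring {L : V ⊕ Fin 2 → Finset ℕ} (b : (V → ℕ) → ℕ)
    (hb : ∀ g, b g ∈ L (Sum.inr 1) ∧ ∀ v, g v ≠ b g) :
    ListColoring (addTwoVertices G) L ⊕ ListColoring (cone G) (coneLists L) →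
      Σ φ : addTwoVertices G ≃g addTwoVertices G,
        MulAction.fixedBy (OrbitColoring (addTwoVertices G) L) φ
  | Sum.inl f => ⟨1, f.toOrbit, one_smul _ _⟩
  | Sum.inr g =>
    open scoped Classical in
    -- If the cone color is also available at y, it is used on both new vertices and the swap fixes
    -- the result.
    if h : g.1 (Sum.inr ()) ∈ L (Sum.inr 1) then
      ⟨swapNew G, ⟨extendColoring (g.1 ∘ Sum.inl) (g.1 (Sum.inr ())) (g.1 (Sum.inr ())),
        isProper_extendColoring (isProper_cone_iff.1 g.2.2).1 (isProper_cone_iff.1 g.2.2).2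
          (isProper_cone_iff.1 g.2.2).2, RelIso.refl _, by
            rintro (v | i)
            · exact g.2.1 (Sum.inl v)
            · fin_cases i
              · exact g.2.1 (Sum.inr ())
              · exact h⟩,
        (smul_orbitColoring_eq_iff _ _ _).2 (by
          funext v
          rcases v with v | i
          · rfl
          · fin_cases i <;> rfl)⟩
    else
      -- Otherwise y gets the cone color, which its list lacks, and x a spare color from the list of
      -- y. This is no `L`-coloring, but swapping x and y makes it one, so it counts as a fixed
      -- point of the identity.
      ⟨1, ⟨extendColoring (g.1 ∘ Sum.inl) (b (g.1 ∘ Sum.inl)) (g.1 (Sum.inr ())),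
        isProper_extendColoring (isProper_cone_iff.1 g.2.2).1 (hb _).2
          (isProper_cone_iff.1 g.2.2).2, swapNew G, by
            rintro (v | i)
            · exact g.2.1 (Sum.inl v)
            · fin_cases i
              · exact g.2.1 (Sum.inr ())
              · exact (hb _).1⟩, one_smul _ _⟩

end Join

section Join

variable {V : Type*} {G : SimpleGraph V}

section toFixedColoring

variable {L : V ⊕ Fin 2 → Finset ℕ} (b : (V → ℕ) → ℕ)
  (hb : ∀ g, b g ∈ L (Sum.inr 1) ∧ ∀ v, g v ≠ b g) (g : ListColoring (cone G) (coneLists L))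

theorem toFixedColoring_fst_of_mem (h : g.1 (Sum.inr ()) ∈ L (Sum.inr 1)) :
    (toFixedColoring b hb (Sum.inr g)).1 = swapNew G := by
  rw [toFixedColoring, dif_pos h]

theorem toFixedColoring_snd_of_mem (h : g.1 (Sum.inr ()) ∈ L (Sum.inr 1)) :
    (toFixedColoring b hb (Sum.inr g)).2.1.1 =
      extendColoring (g.1 ∘ Sum.inl) (g.1 (Sum.inr ())) (g.1 (Sum.inr ())) := by
  rw [toFixedColoring, dif_pos h]

theorem toFixedColoring_fst_of_notMem (h : g.1 (Sum.inr ()) ∉ L (Sum.inr 1)) :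
    (toFixedColoring b hb (Sum.inr g)).1 = 1 := by
  rw [toFixedColoring, dif_neg h]

theorem toFixedColoring_snd_of_notMem (h : g.1 (Sum.inr ()) ∉ L (Sum.inr 1)) :
    (toFixedColoring b hb (Sum.inr g)).2.1.1 =
      extendColoring (g.1 ∘ Sum.inl) (b (g.1 ∘ Sum.inl)) (g.1 (Sum.inr ())) := by
  rw [toFixedColoring, dif_neg h]

end toFixedColoring

/-- The automorphism singles out the swap branch. Under the identity, the color of y reveals the
origin: it is in the list of y exactly for the genuine `L`-colorings. In either branch the cone
coloring can be read off. -/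
theorem toFixedColoring_injective {L : V ⊕ Fin 2 → Finset ℕ} (b : (V → ℕ) → ℕ)
    (hb : ∀ g, b g ∈ L (Sum.inr 1) ∧ ∀ v, g v ≠ b g) :
    Function.Injective (toFixedColoring (G := G) b hb) := by
  intro p q h
  have hfst := congrArg (fun x => x.1) h
  have hsnd := congrArg (fun x => x.2.1.1) h
  have hcone : ∀ g g' : ListColoring (cone G) (coneLists L),
      (∀ v, g.1 (Sum.inl v) = g'.1 (Sum.inl v)) → g.1 (Sum.inr ()) = g'.1 (Sum.inr ()) →
      g = g' := by
    intro g g' h1 h2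
    refine Subtype.ext (funext ?_)
    rintro (v | ⟨⟩)
    · exact h1 v
    · exact h2
  have hmixed : ∀ (f : ListColoring (addTwoVertices G) L)
      (g : ListColoring (cone G) (coneLists L)),
      toFixedColoring b hb (Sum.inl f) ≠ toFixedColoring b hb (Sum.inr g) := by
    intro f g h
    have hfst := congrArg (fun x => x.1) h
    have hsnd := congrArg (fun x => x.2.1.1) h
    by_cases hg : g.1 (Sum.inr ()) ∈ L (Sum.inr 1)
    · rw [toFixedColoring_fst_of_mem _ _ _ hg] at hfst
      exact swapNew_ne_one G hfst.symm
    · rw [toFixedColoring_snd_of_notMem _ _ _ hg] at hsnd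
      have h1 : f.1 (Sum.inr 1) = g.1 (Sum.inr ()) := congrFun hsnd (Sum.inr 1)
      exact hg (h1 ▸ f.2.1 (Sum.inr 1))
  rcases p with f | g <;> rcases q with f' | g'
  · exact congrArg Sum.inl (Subtype.ext hsnd)
  · exact (hmixed f g' h).elim
  · exact (hmixed f' g h.symm).elim
  · congr 1
    by_cases hg : g.1 (Sum.inr ()) ∈ L (Sum.inr 1) <;>
      by_cases hg' : g'.1 (Sum.inr ()) ∈ L (Sum.inr 1)
    · rw [toFixedColoring_snd_of_mem _ _ _ hg, toFixedColoring_snd_of_mem _ _ _ hg'] at hsnd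
      exact hcone _ _ (fun v => congrFun hsnd (Sum.inl v)) (congrFun hsnd (Sum.inr 0))
    · rw [toFixedColoring_fst_of_mem _ _ _ hg, toFixedColoring_fst_of_notMem _ _ _ hg'] at hfst
      exact (swapNew_ne_one G hfst).elim
    · rw [toFixedColoring_fst_of_notMem _ _ _ hg, toFixedColoring_fst_of_mem _ _ _ hg'] at hfst
      exact (swapNew_ne_one G hfst.symm).elim
    · rw [toFixedColoring_snd_of_notMem _ _ _ hg, toFixedColoring_snd_of_notMem _ _ _ hg'] at hsnd
      exact hcone _ _ (fun v => congrFun hsnd (Sum.inl v)) (congrFun hsnd (Sum.inr 1))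

theorem toFixedColoring_surjective (hpd : PointDetermining G)
    (haut : ∀ π : G ≃g G, π ≠ RelIso.refl G.Adj → HasCycleWithAdjacentVertices G π.toEquiv)
    (S : Finset ℕ) (b : (V → ℕ) → ℕ) (hb : ∀ g, b g ∈ S ∧ ∀ v, g v ≠ b g) :
    Function.Surjective (toFixedColoring (G := G) (L := fun _ => S) b hb) := by
  rintro ⟨φ, f, hf⟩
  have hfS : ∀ v, f.1 v ∈ S := fun v => by
    obtain ⟨ψ, hψ⟩ := f.2.2
    simpa using hψ (ψ.symm v)
  have hf' := (smul_orbitColoring_eq_iff _ _ _).1 hf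
  rcases eq_one_or_eq_swapNew hpd haut φ f.2.1 hf' with rfl | rfl
  · exact ⟨Sum.inl ⟨f.1, hfS, f.2.1⟩, rfl⟩
  · have h01 : f.1 (Sum.inr 1) = f.1 (Sum.inr 0) := congrFun hf' (Sum.inr 1)
    obtain ⟨hp, hne⟩ := isProper_addTwoVertices_iff.1 f.2.1
    refine ⟨Sum.inr ⟨Sum.elim (f.1 ∘ Sum.inl) fun _ => f.1 (Sum.inr 0), ?_,
      isProper_cone_iff.2 ⟨hp, fun v => hne v 0⟩⟩, ?_⟩
    · rintro (v | _)
      · exact hfS _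
      · exact hfS _
    -- With constant lists the cone color is always available at y, so only the swap branch occurs.
    · have hmem : f.1 (Sum.inr 0) ∈ S := hfS _
      refine (dif_pos hmem).trans ?_
      refine Sigma.ext rfl (heq_of_eq (Subtype.ext (Subtype.ext (funext ?_))))
      rintro (v | i)
      · rfl
      · fin_cases i
        · rfl
        · exact h01.symm

theorem exists_mem_forall_ne [Fintype V] {S : Finset ℕ} (hS : Fintype.card V < S.card)
    (g : V → ℕ) : ∃ b ∈ S, ∀ v, g v ≠ b := by
  obtain ⟨b, hb, hg⟩ := Finset.exists_mem_notMem_of_card_lt_card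
    ((Finset.card_image_le (s := Finset.univ) (f := g)).trans_lt hS)
  exact ⟨b, hb, fun v hv => hg (Finset.mem_image.2 ⟨v, Finset.mem_univ v, hv⟩)⟩

/-- For large `k`, no `k`-assignment of `addTwoVertices G` admits fewer proper list colorings up to
equivalence than the constant one. -/
theorem exists_numListColorings_const_le [Fintype V] (hpd : PointDetermining G)
    (haut : ∀ π : G ≃g G, π ≠ RelIso.refl G.Adj → HasCycleWithAdjacentVertices G π.toEquiv) :
    ∃ N : ℕ, ∀ k, N ≤ k → ∀ L : V ⊕ Fin 2 → Finset ℕ, IsAssignment k L →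
      numListColorings (addTwoVertices G) (fun _ => Finset.range k) ≤
        numListColorings (addTwoVertices G) L := by
  classical
  obtain ⟨N₁, h₁⟩ := exists_card_listColoring_const_le (addTwoVertices G)
  obtain ⟨N₂, h₂⟩ := exists_card_listColoring_const_le (cone G)
  -- The last bound leaves a color in the list of y unused on `V`, as `toFixedColoring` requires.
  refine ⟨max (max N₁ N₂) (Fintype.card V + 1), fun k hk L hL => ?_⟩
  have hcard : Fintype.card V < k := by omega
  have : Finite (addTwoVertices G ≃g addTwoVertices G) :=
    Finite.of_injective (fun φ => (φ : V ⊕ Fin 2 → V ⊕ Fin 2)) DFunLike.coe_injective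
  have hfin : ∀ {W : Type _} [Finite W] (H : SimpleGraph W) (L : W → Finset ℕ),
      Finite (ListColoring H L) := fun H L =>
    Finite.of_injective ListColoring.toOrbit fun f g h => Subtype.ext (congrArg (fun x => x.1) h)
  refine Nat.le_of_mul_le_mul_right ?_ (Nat.card_pos (α := addTwoVertices G ≃g addTwoVertices G))
  rw [numListColorings_mul_card, numListColorings_mul_card]
  choose b hb using exists_mem_forall_ne (V := V) (S := L (Sum.inr 1)) (by rwa [hL])
  choose b' hb' using exists_mem_forall_ne (V := V) (S := Finset.range k)
    (by rwa [Finset.card_range])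
  have hle := Nat.card_le_card_of_injective _ (toFixedColoring_injective (G := G) b hb)
  have hge := Nat.card_le_card_of_surjective _
    (toFixedColoring_surjective hpd haut (Finset.range k) b' hb')
  rw [Nat.card_sum] at hle hge
  refine hge.trans (le_trans (add_le_add (h₁ k (by omega) L hL) ?_) hle)
  have hconst : coneLists (fun _ : V ⊕ Fin 2 => Finset.range k) = fun _ => Finset.range k := by
    funext v
    rcases v with v | v <;> rfl
  rw [hconst]
  refine h₂ k (by omega) _ ?_
  rintro (v | v)
  · exact hL _
  · exact hL _

end Join

/-! ### Transfer to unlabeled graphs -/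

namespace UnlabeledGraph

/-- Every orbit contains a pair whose graph is `H` itself, and the permutations that carry `H` to
`H` are its automorphisms. -/
theorem numColorings_mk {n : ℕ} (H : SimpleGraph (Fin n)) (k : ℕ) :
    (mk H).numColorings k = numListColorings H fun _ => Finset.range k := by
  let F : ListColoring H (fun _ => Finset.range k) → LabeledColoring (mk H) k := fun f =>
    ⟨(H, fun v => ⟨f.1 v, Finset.mem_range.1 (f.2.1 v)⟩), rfl,
      fun u v h heq => f.2.2 u v h (congrArg Fin.val heq)⟩
  have hrel : ∀ f g, (listColoringSetoid H _).r f g ↔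
      MulAction.orbitRel (Equiv.Perm (Fin n)) (LabeledColoring (mk H) k) (F f) (F g) := by
    intro f g
    constructor
    · rintro ⟨π, h⟩
      refine ⟨π.toEquiv, Subtype.ext (Prod.ext ?_ ?_)⟩
      · change H.map π.toEquiv = H
        ext u v
        constructor
        · rintro ⟨-, a, b, hab, rfl, rfl⟩
          exact π.map_adj_iff.2 hab
        · intro huv
          exact ⟨huv.ne, π.symm u, π.symm v, π.symm.map_adj_iff.2 huv, by simp, by simp⟩
      · funext v
        refine Fin.ext ?_
        change g.1 (π.symm v) = f.1 v
        rw [← h]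
        simp
    · rintro ⟨π, h⟩
      have h1 : H.map π = H := congrArg (fun p => p.1.1) h
      have h2 : ∀ v, g.1 (π.symm v) = f.1 v := fun v =>
        congrArg (fun p => ((p.1.2 v : Fin k) : ℕ)) h
      refine ⟨⟨π, fun {a b} => ?_⟩, funext fun v => ?_⟩
      · conv_lhs => rw [← h1]
        exact SimpleGraph.map_adj_apply (f := π.toEmbedding)
      · change f.1 (π v) = g.1 v
        rw [← h2, Equiv.symm_apply_apply]
  symm
  refine Nat.card_congr (Equiv.ofBijective
    (Quotient.map' F fun f g h => (hrel f g).1 h) ⟨?_, ?_⟩)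
  · rintro ⟨f⟩ ⟨g⟩ h
    exact Quotient.sound ((hrel f g).2 (Quotient.exact h))
  · rintro ⟨⟨⟨K, f⟩, hK, hf⟩⟩
    obtain ⟨e⟩ : Nonempty (K ≃g H) := Quotient.exact hK
    refine ⟨Quotient.mk _ ⟨fun v => f (e.symm v), fun v => Finset.mem_range.2 (f _).2,
      fun u v huv heq => hf _ _ (e.symm.map_adj_iff.2 huv) (Fin.ext heq)⟩, Quotient.sound ?_⟩
    refine ⟨e.toEquiv, Subtype.ext (Prod.ext ?_ rfl)⟩
    change K.map e.toEquiv = H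
    ext u v
    constructor
    · rintro ⟨-, a, b, hab, rfl, rfl⟩
      exact e.map_adj_iff.2 hab
    · intro huv
      exact ⟨huv.ne, e.symm u, e.symm v, e.symm.map_adj_iff.2 huv, by simp, by simp⟩

theorem numColorings_of {V : Type*} [Fintype V] (H : SimpleGraph V) (k : ℕ) :
    (of H).numColorings k = numListColorings H fun _ => Finset.range k := by
  rw [of, numColorings_mk]
  exact numListColorings_iso (SimpleGraph.Iso.map (Fintype.equivFin V) H) fun _ => Finset.range k

theorem listColorFunction_of {V : Type*} [Fintype V] (H : SimpleGraph V) (k : ℕ) :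
    (of H).listColorFunction k = minNumListColorings H k :=
  (minNumListColorings_iso (SimpleGraph.Iso.map (Fintype.equivFin V) H) k).symm

end UnlabeledGraph

end UnlabeledColoring

theorem mainTheorem3 {V : Type*} [Fintype V] (G : SimpleGraph V)
    (hpd : UnlabeledColoring.PointDetermining G)
    (haut : ∀ π : G ≃g G, π ≠ RelIso.refl G.Adj →
      UnlabeledColoring.HasCycleWithAdjacentVertices G π.toEquiv) :
    ∃ N : ℕ, ∀ k : ℕ, N ≤ k →
      (UnlabeledColoring.UnlabeledGraph.of
        (UnlabeledColoring.addTwoVertices G)).listColorFunction k =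
      (UnlabeledColoring.UnlabeledGraph.of
        (UnlabeledColoring.addTwoVertices G)).numColorings k := by
  obtain ⟨N, hN⟩ := UnlabeledColoring.exists_numListColorings_const_le hpd haut
  refine ⟨N, fun k hk => ?_⟩
  rw [UnlabeledColoring.UnlabeledGraph.listColorFunction_of,
    UnlabeledColoring.UnlabeledGraph.numColorings_of]
  obtain ⟨⟨L, hL, hmin⟩, hle⟩ :=
    UnlabeledColoring.minNumListColorings_isLeast (UnlabeledColoring.addTwoVertices G) k
  exact le_antisymm (hle ⟨_, fun _ => Finset.card_range k, rfl⟩) (hmin ▸ hN k hk L hL)
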